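/- Let $\mathfrak K$ be a field, $\Gamma$ a finite quiver, and $\Lambda=\mathfrak K\Gamma/I$ the quotient of its path algebra by an admissible ideal $I$ (so that $\Lambda$ is finite-dimensional), with Jacobson radical $J$. Paths are composed from right to left, and paths are identified with their classes in $\Lambda$; $\mathrm s(p)$ denotes the starting point of a path $p$, and also the corresponding idempotent. Modules are finitely generated left $\Lambda$-modules. A module is uniserial if it has exactly one composition series; a mast of a uniserial module $U$ of length $n$ is a path $p$ of length $n-1$ such that $px\neq 0$ for some $x\in U$. A path $u$ is a right subpath of a path $p$ if $p=ru$ for some path $r$. A detour on $p$ is a pair $(\alpha,u)$ of an arrow $\alpha$ and a right subpath $u$ of $p$ such that $\alpha u$ is a path which is not a right subpath of $p$, but some right subpath $v$ of $p$ with $\operatorname{length}(v)\ge\operatorname{length}(u)+1$ has the same end point as $\alpha$. If $p$ passes consecutively through the vertices $e(1),\dots,e(l+1)$, then a route on $p$ is a path starting in $e(1)$ whose sequence of vertices is a subsequence of $(e(1),\dots,e(l+1))$; a non-route on $p$ is a path starting in $e(1)$ which is not a route on $p$. A detour $(\alpha,u)$ on $p$ is inessential if in $\Lambda$ $$\alpha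 u = s+\sum_i k_i v_i,$$ where $s$ is a $\mathfrak K$-linear combination of paths none of which is a route on $p$, the $v_i$ are the right subpaths of $p$ which are longer than $u$ and have the same end point as $\alpha$, and $k_i\in\mathfrak K$. Theorem. Let $U$ be a non-simple uniserial $\Lambda$-module with mast $p$, where $p$ does not start with an oriented cycle (that is, no right subpath of $p$ of positive length ends in $\mathrm s(p)$). Suppose that the embedding $JU\hookrightarrow U$ is irreducible, that is, it is neither a split monomorphism nor a split epimorphism, and whenever it is a composition $h\circ g$ of homomorphisms of finitely generated modules, $g$ is a split monomorphism or $h$ is a split epimorphism. Then: (i) all detours on $p$ are inessential; (ii) all non-routes on $p$ lie in $Jp$. In particular, $U\cong\Lambda e/Jp$ with $e=\mathrm s(p)$. -/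

import Mathlib

universe u v w

namespace QuiverAlgebra

open Quiver

/-! ### The path algebra of a finite quiver -/

section PathAlgebra

/-- A path of the quiver, of arbitrary length (length `0` included), bundled with its starting
point and its end point. -/
structure QPath (V : Type v) [Quiver.{w} V] : Type (max v w) where
  src : V
  tgt : V
  path : Path src tgt

/-- The underlying vector space of the path algebra: the `k`-vector space with basis the set of
all paths. -/
def PathAlgebra (k : Type u) (V : Type v) [Field k] [Quiver.{w} V] : Type (max u v w) :=
  QPath V →₀ k

variable {k : Type u} {V : Type v} [Field k] [Quiver.{w} V]

noncomputable instance : AddCommGroup (PathAlgebra k V) :=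
  inferInstanceAs (AddCommGroup (QPath V →₀ k))

noncomputable instance : Module k (PathAlgebra k V) :=
  inferInstanceAs (Module k (QPath V →₀ k))

variable (k) in
/-- The basis element of the path algebra given by a bundled path. -/
noncomputable def basisElt (q : QPath V) : PathAlgebra k V := Finsupp.single q (1 : k)

variable (k) in
/-- A path, viewed as an element of the path algebra. -/
noncomputable def ofPath {a b : V} (p : Path a b) : PathAlgebra k V := basisElt k ⟨a, b, p⟩

open Classical in
variable (k) in
/-- The product `q p` of two paths. Paths are composed from right to left: `q p` is `p` followed
by `q` if `p` ends where `q` starts, and `0` otherwise. -/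
noncomputable def pathMul (q p : QPath V) : PathAlgebra k V :=
  if h : p.tgt = q.src then ofPath k (p.path.comp (q.path.cast h.symm rfl)) else 0

/-- The bilinear extension of the product of paths. -/
noncomputable def mulBilin : PathAlgebra k V →ₗ[k] PathAlgebra k V →ₗ[k] PathAlgebra k V :=
  Finsupp.linearCombination k fun q : QPath V =>
    (Finsupp.linearCombination k fun p : QPath V => pathMul k q p :
      (QPath V →₀ k) →ₗ[k] PathAlgebra k V)

noncomputable instance : Mul (PathAlgebra k V) := ⟨fun x y => mulBilin x y⟩

noncomputable instance [Fintype V] : One (PathAlgebra k V) :=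
  ⟨∑ a : V, ofPath k (Path.nil : Path a a)⟩

theorem mul_def (x y : PathAlgebra k V) : x * y = mulBilin x y := rfl

theorem one_def [Fintype V] :
    (1 : PathAlgebra k V) = ∑ a : V, ofPath k (Path.nil : Path a a) := rfl

theorem basisElt_mul_basisElt (q p : QPath V) :
    basisElt k q * basisElt k p = pathMul k q p := by
  rw [mul_def, mulBilin, basisElt, basisElt]
  erw [Finsupp.linearCombination_single, one_smul, Finsupp.linearCombination_single, one_smul]

theorem ofPath_mul_ofPath {a b c : V} (q : Path b c) (p : Path a b) :
    ofPath k q * ofPath k p = ofPath k (p.comp q) := by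
  rw [ofPath, ofPath, basisElt_mul_basisElt, pathMul]
  simp

theorem ofPath_mul_ofPath_of_ne {a b c d : V} (q : Path c d) (p : Path a b) (h : b ≠ c) :
    ofPath k q * ofPath k p = 0 := by
  rw [ofPath, ofPath, basisElt_mul_basisElt, pathMul]
  simp [h]

/-- Induction principle: an additive and homogeneous property of elements of the path algebra
holds as soon as it holds for paths. -/
theorem path_induction {P : PathAlgebra k V → Prop} (x : PathAlgebra k V) (h0 : P 0)
    (hadd : ∀ x y, P x → P y → P (x + y)) (hsmul : ∀ (c : k) x, P x → P (c • x))
    (hpath : ∀ {a b : V} (p : Path a b), P (ofPath k p)) : P x := by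
  refine Finsupp.induction_linear (motive := P) x h0 hadd ?_
  rintro ⟨a, b, p⟩ c
  have : (Finsupp.single (⟨a, b, p⟩ : QPath V) c : QPath V →₀ k)
      = c • (Finsupp.single (⟨a, b, p⟩ : QPath V) (1 : k)) := by simp
  rw [this]
  exact hsmul c _ (hpath p)

theorem add_mul' (x y z : PathAlgebra k V) : (x + y) * z = x * z + y * z := by
  simp [mul_def]

theorem mul_add' (x y z : PathAlgebra k V) : x * (y + z) = x * y + x * z := by
  simp [mul_def]

theorem smul_mul' (c : k) (x y : PathAlgebra k V) : (c • x) * y = c • (x * y) := by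
  simp [mul_def]

theorem mul_smul' (c : k) (x y : PathAlgebra k V) : x * (c • y) = c • (x * y) := by
  simp [mul_def]

theorem zero_mul' (x : PathAlgebra k V) : 0 * x = 0 := by simp [mul_def]

theorem mul_zero' (x : PathAlgebra k V) : x * 0 = 0 := by simp [mul_def]

theorem mul_assoc' (x y z : PathAlgebra k V) : x * y * z = x * (y * z) := by
  refine path_induction (P := fun x => x * y * z = x * (y * z)) x ?_ ?_ ?_ ?_
  · simp only [zero_mul']
  · intro x₁ x₂ h₁ h₂; simp only [add_mul', h₁, h₂]
  · intro c x h; simp only [smul_mul', h]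
  intro a b r
  refine path_induction (P := fun y => ofPath k r * y * z = ofPath k r * (y * z)) y ?_ ?_ ?_ ?_
  · simp only [zero_mul', mul_zero']
  · intro x₁ x₂ h₁ h₂; simp only [add_mul', mul_add', h₁, h₂]
  · intro c x h; simp only [smul_mul', mul_smul', h]
  intro c d q
  refine path_induction
    (P := fun z => ofPath k r * ofPath k q * z = ofPath k r * (ofPath k q * z)) z ?_ ?_ ?_ ?_
  · simp only [mul_zero']
  · intro x₁ x₂ h₁ h₂; simp only [mul_add', h₁, h₂]
  · intro c x h; simp only [mul_smul', h]
  intro e f p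
  by_cases h₁ : d = a
  · subst h₁
    by_cases h₂ : f = c
    · subst h₂
      simp only [ofPath_mul_ofPath, Path.comp_assoc]
    · simp only [ofPath_mul_ofPath, ofPath_mul_ofPath_of_ne _ _ h₂, mul_zero']
  · by_cases h₂ : f = c
    · subst h₂
      simp only [ofPath_mul_ofPath, ofPath_mul_ofPath_of_ne _ _ h₁, zero_mul']
    · simp only [ofPath_mul_ofPath_of_ne _ _ h₁, ofPath_mul_ofPath_of_ne _ _ h₂, zero_mul',
        mul_zero']

theorem one_mul' [Fintype V] (x : PathAlgebra k V) : 1 * x = x := by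
  refine path_induction (P := fun x => 1 * x = x) x (mul_zero' _) ?_ ?_ ?_
  · intro x₁ x₂ h₁ h₂; simp only [mul_add', h₁, h₂]
  · intro c x h; simp only [mul_smul', h]
  intro a b p
  rw [one_def, mul_def, map_sum, LinearMap.sum_apply, Finset.sum_eq_single b]
  · rw [← mul_def, ofPath_mul_ofPath, Path.comp_nil]
  · intro c _ hc
    rw [← mul_def, ofPath_mul_ofPath_of_ne _ _ hc.symm]
  · intro h; exact absurd (Finset.mem_univ b) h

theorem mul_one' [Fintype V] (x : PathAlgebra k V) : x * 1 = x := by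
  refine path_induction (P := fun x => x * 1 = x) x (zero_mul' _) ?_ ?_ ?_
  · intro x₁ x₂ h₁ h₂; simp only [add_mul', h₁, h₂]
  · intro c x h; simp only [smul_mul', h]
  intro a b p
  rw [one_def, mul_def, map_sum, Finset.sum_eq_single a]
  · rw [← mul_def, ofPath_mul_ofPath, Path.nil_comp]
  · intro c _ hc
    rw [← mul_def, ofPath_mul_ofPath_of_ne _ _ hc]
  · intro h; exact absurd (Finset.mem_univ a) h

noncomputable instance [Fintype V] : Ring (PathAlgebra k V) :=
  { (inferInstance : AddCommGroup (PathAlgebra k V)),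
    (inferInstance : Mul (PathAlgebra k V)),
    (inferInstance : One (PathAlgebra k V)) with
    left_distrib := mul_add'
    right_distrib := add_mul'
    zero_mul := zero_mul'
    mul_zero := mul_zero'
    mul_assoc := mul_assoc'
    one_mul := one_mul'
    mul_one := mul_one' }

noncomputable instance [Fintype V] : Algebra k (PathAlgebra k V) :=
  Algebra.ofModule smul_mul' mul_smul'

variable (k V) in
/-- The span of all paths of length at least `m`, which is the `m`-th power of the ideal of the
path algebra generated by the arrows. -/
noncomputable def longPaths (m : ℕ) : Submodule k (PathAlgebra k V) :=
  Submodule.span k {x | ∃ q : QPath V, m ≤ q.path.length ∧ x = basisElt k q}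

/-- An ideal of the path algebra is admissible if it lies between some power of the arrow ideal
and the square of the arrow ideal. -/
def IsAdmissible [Fintype V] (I : Ideal (PathAlgebra k V)) : Prop :=
  (∃ m : ℕ, 2 ≤ m ∧ (longPaths k V m : Set (PathAlgebra k V)) ⊆ I) ∧
    (I : Set (PathAlgebra k V)) ⊆ longPaths k V 2

/-- The class of a path in the quotient `Λ = kΓ/I` of the path algebra. -/
noncomputable def cls [Fintype V] (I : Ideal (PathAlgebra k V)) {a b : V} (p : Path a b) :
    PathAlgebra k V ⧸ I :=
  Submodule.Quotient.mk (ofPath k p)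

end PathAlgebra

/-! ### Combinatorics of paths: right subpaths, detours, routes -/

section Combinatorics

variable {V : Type v} [Quiver.{w} V]

/-- `u` is a right subpath of `p`: there is a path `r` with `p = r u` (first `u`, then `r`). -/
def IsRightSubpath {a b c : V} (u : Path a c) (p : Path a b) : Prop :=
  ∃ r : Path c b, u.comp r = p

/-- `p` starts with an oriented cycle: some right subpath of `p` of positive length is closed. -/
def StartsWithCycle {a b : V} (p : Path a b) : Prop :=
  ∃ c : Path a a, 0 < c.length ∧ IsRightSubpath c p

/-- `(α, u)` is a detour on `p`. -/
def IsDetour {a b c d : V} (p : Path a b) (α : c ⟶ d) (u : Path a c) : Prop :=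
  IsRightSubpath u p ∧ ¬ IsRightSubpath (u.cons α) p ∧
    ∃ v : Path a d, IsRightSubpath v p ∧ u.length + 1 ≤ v.length

/-- `q` is a route on `p`: it starts where `p` starts, and the sequence of vertices through which
it passes is a subsequence of the sequence of vertices of `p`. -/
def IsRoute {a b : V} (p : Path a b) (q : QPath V) : Prop :=
  q.src = a ∧ q.path.vertices.Sublist p.vertices

/-- `q` is a non-route on `p`: it starts where `p` starts, but it is not a route on `p`. -/
def IsNonRoute {a b : V} (p : Path a b) (q : QPath V) : Prop :=
  q.src = a ∧ ¬ IsRoute p q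

end Combinatorics

section Bound

variable {k : Type u} {V : Type v} [Field k] [Quiver.{w} V] [Fintype V]
  (I : Ideal (PathAlgebra k V)) [I.IsTwoSided]

/-- The detour `(α, u)` on `p` is inessential: in `Λ = kΓ/I`, the element `α u` is the sum of a
linear combination of paths none of which is a route on `p`, and of a linear combination of right
subpaths of `p` that are longer than `u` and have the same end point as `α`. -/
def IsInessential {a b c d : V} (p : Path a b) (α : c ⟶ d) (u : Path a c) : Prop :=
  ∃ s ∈ Submodule.span k {x : PathAlgebra k V ⧸ I |
      ∃ q : QPath V, ¬ IsRoute p q ∧ x = cls I q.path},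
  ∃ t ∈ Submodule.span k {x : PathAlgebra k V ⧸ I |
      ∃ v : Path a d, IsRightSubpath v p ∧ u.length < v.length ∧ x = cls I v},
    cls I (u.cons α) = s + t

/-- `Λe`, for the vertex `e`. -/
noncomputable def leftProj (e : V) : Submodule (PathAlgebra k V ⧸ I) (PathAlgebra k V ⧸ I) :=
  Submodule.span _ {cls I (Path.nil : Path e e)}

/-- `Jp = {r p | r ∈ J}`, where `J` is the Jacobson radical of `Λ`. -/
noncomputable def radMulPath {a b : V} (p : Path a b) :
    Submodule (PathAlgebra k V ⧸ I) (PathAlgebra k V ⧸ I) :=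
  Submodule.map (LinearMap.toSpanSingleton (PathAlgebra k V ⧸ I) (PathAlgebra k V ⧸ I) (cls I p))
    (Ring.jacobson (PathAlgebra k V ⧸ I))

end Bound

/-! ### Uniserial modules and irreducible maps -/

section Modules

variable (R : Type u) [Ring R] (M : Type v) [AddCommGroup M] [Module R M]

/-- A module is uniserial if it has exactly one composition series (from `0` to the whole module,
with simple factors). In particular it has finite length. -/
def IsUniserial : Prop :=
  ∃! s : CompositionSeries (Submodule R M), s.head = ⊥ ∧ s.last = ⊤

/-- The submodule `JM`, where `J` is the Jacobson radical of the ring. -/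
def radical : Submodule R M := Ring.jacobson R • (⊤ : Submodule R M)

variable {R M} {N : Type v} [AddCommGroup N] [Module R N]

/-- `f` is a split monomorphism. -/
def IsSplitMonoMap (f : M →ₗ[R] N) : Prop := ∃ g : N →ₗ[R] M, g ∘ₗ f = LinearMap.id

/-- `f` is a split epimorphism. -/
def IsSplitEpiMap (f : M →ₗ[R] N) : Prop := ∃ g : N →ₗ[R] M, f ∘ₗ g = LinearMap.id

/-- A homomorphism of finitely generated modules is irreducible (in the category of finitely
generated modules) if it is neither a split monomorphism nor a split epimorphism, and in each of
its factorizations `f = h ∘ g` through a finitely generated module, `g` is a split monomorphism or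
`h` is a split epimorphism. -/
def IsIrreducibleMap (f : M →ₗ[R] N) : Prop :=
  ¬ IsSplitMonoMap f ∧ ¬ IsSplitEpiMap f ∧
    ∀ (X : Type v) [AddCommGroup X] [Module R X] [Module.Finite R X]
      (g : M →ₗ[R] X) (h : X →ₗ[R] N), h ∘ₗ g = f → IsSplitMonoMap g ∨ IsSplitEpiMap h

end Modules

section Mast

variable {k : Type u} {V : Type v} [Field k] [Quiver.{w} V] [Fintype V]
  (I : Ideal (PathAlgebra k V)) [I.IsTwoSided]

/-- `p` is a mast of the (uniserial) module `U`: the length of `U` is one more than the length of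
`p`, and `p x ≠ 0` for some `x` in `U`. -/
def IsMast {a b : V} (p : Path a b) (U : Type*) [AddCommGroup U]
    [Module (PathAlgebra k V ⧸ I) U] : Prop :=
  Module.length (PathAlgebra k V ⧸ I) U = ((p.length + 1 : ℕ) : ℕ∞) ∧ ∃ x : U, cls I p • x ≠ 0

end Mast

end QuiverAlgebra

open QuiverAlgebra

/-!
Let `x` be a top element of `U` with `e x = x`, so that `a ↦ a x` is a projective cover `Λe → U`.

The radical layers of `U` are spanned by the elements `u x`, for `u` a right subpath of `p`. Hence
an arrow `α` sends `u x` to a linear combination of elements `v x`, where `v` runs over the right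
subpaths of `p` which properly extend `u` and end where `α` does. Iterating this, a path `q` from
`e` acts on `x` like a linear combination of right subpaths of `p` whose vertex sequences contain
that of `q`; if `q` is a non-route there are none, so `q x = 0`. Everything is therefore contained
in the claim that the kernel of `Λe → U` is `Jp`.

For this, factor `JU ↪ U` through the fibre product of `U → U / JU` and `Λe / Λp → U / JU`. As `p`
does not start with an oriented cycle, `e (JU) = 0`, so that every homomorphism `Λe → JU` vanishes.
If the first factor splits, this forces `Λp` into the kernel, contradicting `p x ≠ 0`. If the second
one splits, the section of it lifts to an endomorphism of `Λe` over `U`, which is surjective and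
sends the kernel into `Λp`. So the kernel lies in `Λp`, and the elements of `Λp` killing `x` are
those of `Jp`.
-/

namespace QuiverAlgebra

open Quiver

section IrreducibleInclusion

variable {R : Type u} [Ring R] {P U : Type v} [AddCommGroup P] [Module R P] [AddCommGroup U]
  [Module R U]

theorem eq_top_of_sup_jacobson_eq_top [Module.Finite R P] {N : Submodule R P}
    (h : N ⊔ Module.jacobson R P = ⊤) : N = ⊤ := by
  rcases eq_top_or_exists_le_coatom N with hN | ⟨M, hM, hNM⟩
  · exact hN
  · exact absurd (top_unique (h ▸ sup_le hNM (sInf_le hM))) hM.1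

theorem surjective_of_comp_eq_of_ker_le_jacobson [Module.Finite R P] {π : P →ₗ[R] U}
    (hK : LinearMap.ker π ≤ Module.jacobson R P) {φ : P →ₗ[R] P} (hφ : π ∘ₗ φ = π) :
    Function.Surjective φ := by
  refine LinearMap.range_eq_top.1 (eq_top_of_sup_jacobson_eq_top (eq_top_iff.2 fun a _ => ?_))
  have ha : a - φ a ∈ LinearMap.ker π := by
    rw [LinearMap.mem_ker, map_sub, sub_eq_zero]
    exact (LinearMap.congr_fun hφ a).symm
  exact Submodule.mem_sup.2 ⟨φ a, ⟨a, rfl⟩, a - φ a, hK ha, by abel⟩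

/-- The fibre product of the projection `U → U / W` and the map `P / Q → U / W` induced by `π`,
where `Q ≤ π⁻¹(W)`. It is written as a sum of two finitely generated modules, because irreducible
maps are tested on finitely generated modules only. -/
def fiberProduct (π : P →ₗ[R] U) (W : Submodule R U) (Q : Submodule R P) :
    Submodule R (U × P ⧸ Q) :=
  LinearMap.range (π.prod Q.mkQ) ⊔ W.map (LinearMap.inl R U (P ⧸ Q))

theorem mk_mem_fiberProduct {π : P →ₗ[R] U} {W : Submodule R U} {Q : Submodule R P}
    (hQ : Q ≤ W.comap π) {y : U} {a : P} : (y, Q.mkQ a) ∈ fiberProduct π W Q ↔ y - π a ∈ W := by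
  constructor
  · intro h
    obtain ⟨_, ⟨b, rfl⟩, _, ⟨w, hw, rfl⟩, h⟩ := Submodule.mem_sup.1 h
    obtain ⟨rfl, hba⟩ : π b + w = y ∧ Q.mkQ b = Q.mkQ a := by simpa using h
    have hba : π (b - a) ∈ W := hQ ((Submodule.Quotient.eq Q).1 hba)
    have : π b + w - π a = π (b - a) + w := by rw [map_sub]; abel
    exact this ▸ add_mem hba hw
  · exact fun h => Submodule.mem_sup.2 ⟨_, ⟨a, rfl⟩, _, ⟨_, h, rfl⟩, by simp⟩

theorem finite_fiberProduct [Module.Finite R P] (π : P →ₗ[R] U) {W : Submodule R U} (hW : W.FG)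
    (Q : Submodule R P) : Module.Finite R (fiberProduct π W Q) :=
  Module.Finite.iff_fg.2 ((Submodule.fg_range _).sup (hW.map _))

theorem le_ker_or_ker_le_of_isIrreducibleMap [Module.Finite R P] [Module.Projective R P]
    {π : P →ₗ[R] U} (hK : LinearMap.ker π ≤ Module.jacobson R P) {W : Submodule R U}
    (hfg : W.FG) (hW : IsIrreducibleMap W.subtype) (hom : ∀ φ : P →ₗ[R] W, φ = 0)
    {Q : Submodule R P} (hQ : Q ≤ W.comap π) :
    Q ≤ LinearMap.ker π ∨ LinearMap.ker π ≤ Q := by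
  have := finite_fiberProduct π hfg Q
  let g : W →ₗ[R] fiberProduct π W Q := (LinearMap.inl R U (P ⧸ Q) ∘ₗ W.subtype).codRestrict _
    fun w => Submodule.mem_sup_right ⟨w, w.2, rfl⟩
  let h : fiberProduct π W Q →ₗ[R] U := LinearMap.fst R U (P ⧸ Q) ∘ₗ (fiberProduct π W Q).subtype
  refine (hW.2.2 _ g h rfl).imp ?_ ?_
  · rintro ⟨ρ, hρ⟩ q hq
    let ι : P →ₗ[R] fiberProduct π W Q := (π.prod Q.mkQ).codRestrict _
      fun a => Submodule.mem_sup_left ⟨a, rfl⟩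
    have hιg : ι q = g ⟨π q, hQ hq⟩ :=
      Subtype.ext (Prod.ext rfl ((Submodule.Quotient.mk_eq_zero Q).2 hq))
    have hρι : ρ (ι q) = 0 := LinearMap.congr_fun (hom (ρ ∘ₗ ι)) q
    have hρg : ρ (g ⟨π q, hQ hq⟩) = ⟨π q, hQ hq⟩ := LinearMap.congr_fun hρ _
    exact congrArg Subtype.val (hρg.symm.trans (hιg ▸ hρι))
  · rintro ⟨σ, hσ⟩ m hm
    let s : U →ₗ[R] P ⧸ Q := LinearMap.snd R U (P ⧸ Q) ∘ₗ (fiberProduct π W Q).subtype ∘ₗ σ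
    have hs (y : U) : (y, s y) ∈ fiberProduct π W Q := by
      have : (y, s y) = (σ y : U × P ⧸ Q) := Prod.ext (LinearMap.congr_fun hσ y).symm rfl
      exact this ▸ (σ y).2
    obtain ⟨φ, hφ⟩ := Module.projective_lifting_property Q.mkQ (s ∘ₗ π) Q.mkQ_surjective
    have hφs (a : P) : Q.mkQ (φ a) = s (π a) := LinearMap.congr_fun hφ a
    have hπφ : π ∘ₗ φ = π := by
      have hmem (a : P) : (π - π ∘ₗ φ) a ∈ W := (mk_mem_fiberProduct hQ).1 (hφs a ▸ hs (π a))
      have hzero := hom ((π - π ∘ₗ φ).codRestrict W hmem)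
      ext a
      exact (sub_eq_zero.1 (congrArg Subtype.val (LinearMap.congr_fun hzero a))).symm
    obtain ⟨n, rfl⟩ := surjective_of_comp_eq_of_ker_le_jacobson hK hπφ m
    have hn : π n = 0 := (LinearMap.congr_fun hπφ n).symm.trans hm
    exact (Submodule.Quotient.mk_eq_zero Q).1 ((hφs n).trans (by rw [hn, map_zero]))

end IrreducibleInclusion

section Idempotents

variable {R : Type*} [Ring R] {ε : R}

theorem mem_span_singleton_iff_mul_eq_self (hε : IsIdempotentElem ε) {a : R} :
    a ∈ Submodule.span R {ε} ↔ a * ε = a := by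
  refine ⟨fun h => ?_, fun h => Submodule.mem_span_singleton.2 ⟨a, h⟩⟩
  obtain ⟨b, rfl⟩ := Submodule.mem_span_singleton.1 h
  rw [smul_eq_mul, mul_assoc, hε]

theorem projective_span_singleton (hε : IsIdempotentElem ε) :
    Module.Projective R (Submodule.span R {ε}) := by
  refine Module.Projective.of_split (Submodule.span R {ε}).subtype
    ((LinearMap.toSpanSingleton R R ε).codRestrict _ fun a =>
      Submodule.smul_mem _ a (Submodule.mem_span_singleton_self ε)) ?_
  ext a
  exact (mem_span_singleton_iff_mul_eq_self hε).1 a.2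

theorem eq_zero_of_isIdempotentElem_of_mem_jacobson (hε : IsIdempotentElem ε)
    (h : ε ∈ Ring.jacobson R) : ε = 0 := by
  refine (Submodule.span_singleton_eq_bot (R := R)).1
    ((Submodule.fg_span_singleton ε).eq_bot_of_le_jacobson_smul ?_)
  exact (Submodule.span_singleton_le_iff_mem _ _).2
    (Submodule.mem_smul_span_singleton.2 ⟨ε, h, hε⟩)

end Idempotents

section Nakayama

variable {R M : Type*} [Ring R] [AddCommGroup M] [Module R M] {y : M}

theorem jacobson_smul_span_singleton_lt (hy : y ≠ 0) :
    Ring.jacobson R • Submodule.span R {y} < Submodule.span R {y} :=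
  Submodule.FG.jacobson_smul_lt (mt Submodule.span_singleton_eq_bot.1 hy)
    (Submodule.fg_span_singleton y)

theorem notMem_jacobson_smul_span_singleton (hy : y ≠ 0) :
    y ∉ Ring.jacobson R • Submodule.span R {y} := fun h =>
  (jacobson_smul_span_singleton_lt hy).not_ge ((Submodule.span_singleton_le_iff_mem _ _).2 h)

theorem one_le_height_span_singleton (hy : y ≠ 0) : 1 ≤ Order.height (Submodule.span R {y}) :=
  Order.one_le_iff_ne_zero.2 fun h =>
    hy (Submodule.span_singleton_eq_bot.1 (isMin_iff_eq_bot.1 (Order.height_eq_zero.1 h)))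

end Nakayama

section Routes

variable {V : Type v} [Quiver.{w} V] {a b : V} {p : Path a b}

theorem vertices_sublist_comp {c : V} (u : Path a c) (w : Path c b) :
    u.vertices.Sublist (u.comp w).vertices := by
  induction w with
  | nil => exact .refl _
  | cons w β ih =>
    rw [Path.comp_cons, Path.vertices_cons, List.concat_eq_append]
    exact ih.trans (List.sublist_append_left _ _)

theorem concat_sublist_vertices_comp {c d : V} {u : Path a c} {w : Path c d} (hw : 0 < w.length)
    {l : List V} (hl : l.Sublist u.vertices) : (l.concat d).Sublist (u.comp w).vertices := by
  cases w with
  | nil => exact absurd hw (lt_irrefl 0)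
  | cons w β =>
    rw [Path.comp_cons, Path.vertices_cons, List.concat_eq_append, List.concat_eq_append]
    exact (hl.trans (vertices_sublist_comp u w)).append (.refl _)

theorem not_isRoute_of_length_lt {q : QPath V} (h : p.length < q.path.length) :
    ¬ IsRoute p q := by
  rintro ⟨-, hs⟩
  exact h.not_ge (by simpa [Path.vertices_length] using hs.length_le)

/-- The right subpaths of positive length of `p`. -/
def positiveRightSubpaths (p : Path a b) : Set (QPath V) :=
  {q | ∃ (d : V) (w : Path a d), 0 < w.length ∧ IsRightSubpath w p ∧ q = ⟨a, d, w⟩}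

/-- The right subpaths of `p` which end in `d` and properly extend `u`. -/
def properExtensions {c : V} (p : Path a b) (u : Path a c) (d : V) : Set (QPath V) :=
  {q | ∃ w : Path c d, 0 < w.length ∧ IsRightSubpath (u.comp w) p ∧ q = ⟨a, d, u.comp w⟩}

end Routes

section PathSpan

variable {k : Type u} {V : Type v} [Field k] [Quiver.{w} V] [Fintype V]
  (I : Ideal (PathAlgebra k V))

/-- The subspace of `Λ = kΓ/I` spanned by the classes of the paths in `S`. -/
noncomputable def pathSpan (S : Set (QPath V)) : Submodule k (PathAlgebra k V ⧸ I) :=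
  Submodule.span k ((fun q => cls I q.path) '' S)

variable {I} {S T : Set (QPath V)}

theorem cls_mem_pathSpan {a b : V} {q : Path a b} (hq : ⟨a, b, q⟩ ∈ S) :
    cls I q ∈ pathSpan I S :=
  Submodule.subset_span ⟨⟨a, b, q⟩, hq, rfl⟩

theorem pathSpan_le {N : Submodule k (PathAlgebra k V ⧸ I)} :
    pathSpan I S ≤ N ↔ ∀ q ∈ S, cls I q.path ∈ N :=
  Submodule.span_le.trans Set.image_subset_iff

theorem pathSpan_mono (h : S ⊆ T) : pathSpan I S ≤ pathSpan I T :=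
  Submodule.span_mono (Set.image_mono h)

variable (I) in
/-- The subspace of `Λ` spanned by the classes of the paths of length at least `n`, which is the
`n`-th power of the ideal generated by the arrows. -/
noncomputable def longSpan (n : ℕ) : Submodule k (PathAlgebra k V ⧸ I) :=
  pathSpan I {q | n ≤ q.path.length}

theorem mem_longSpan_zero (x : PathAlgebra k V ⧸ I) : x ∈ longSpan I 0 := by
  obtain ⟨x, rfl⟩ := Submodule.Quotient.mk_surjective _ x
  exact path_induction (P := fun x => Submodule.Quotient.mk x ∈ longSpan I 0) x
    (zero_mem _) (fun _ _ => add_mem) (fun c _ => Submodule.smul_mem _ c)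
    fun _ => cls_mem_pathSpan (Nat.zero_le _)

theorem longSpan_eq_bot {m : ℕ} (hI : (longPaths k V m : Set (PathAlgebra k V)) ⊆ I) :
    longSpan I m = ⊥ :=
  eq_bot_iff.2 <| pathSpan_le.2 fun q hq =>
    (Submodule.Quotient.mk_eq_zero I).2 (hI (Submodule.subset_span ⟨q, hq, rfl⟩))

variable [I.IsTwoSided]

theorem cls_mul_cls {a b c : V} (q : Path b c) (p : Path a b) :
    cls I q * cls I p = cls I (p.comp q) :=
  congrArg (Ideal.Quotient.mk I) (ofPath_mul_ofPath q p)

theorem cls_mul_cls_of_ne {a b c d : V} (q : Path c d) (p : Path a b) (h : b ≠ c) :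
    cls I q * cls I p = 0 :=
  congrArg (Ideal.Quotient.mk I) (ofPath_mul_ofPath_of_ne q p h)

theorem one_eq_sum_cls : (1 : PathAlgebra k V ⧸ I) = ∑ a : V, cls I (Path.nil : Path a a) :=
  (congrArg (Ideal.Quotient.mk I) one_def).trans (map_sum _ _ _)

theorem isIdempotentElem_cls_nil (a : V) : IsIdempotentElem (cls I (Path.nil : Path a a)) :=
  cls_mul_cls _ _

theorem mul_mem_pathSpan {S' : Set (QPath V)}
    (h : ∀ {a b c : V} {q : Path b c} {p : Path a b}, ⟨b, c, q⟩ ∈ S → ⟨a, b, p⟩ ∈ T →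
      ⟨a, c, p.comp q⟩ ∈ S') {x y : PathAlgebra k V ⧸ I} (hx : x ∈ pathSpan I S)
    (hy : y ∈ pathSpan I T) : x * y ∈ pathSpan I S' := by
  suffices hle : pathSpan I S * pathSpan I T ≤ pathSpan I S' from hle (Submodule.mul_mem_mul hx hy)
  rw [pathSpan, pathSpan, Submodule.span_mul_span, Submodule.span_le]
  rintro _ ⟨_, ⟨⟨b, c, q⟩, hq, rfl⟩, _, ⟨⟨a, b', p⟩, hp, rfl⟩, rfl⟩
  change cls I q * cls I p ∈ pathSpan I S'
  by_cases hb : b' = b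
  · subst hb
    exact cls_mul_cls (I := I) q p ▸ cls_mem_pathSpan (h hq hp)
  · exact cls_mul_cls_of_ne (I := I) q p hb ▸ zero_mem _

theorem mul_mem_longSpan {m n : ℕ} {x y : PathAlgebra k V ⧸ I} (hx : x ∈ longSpan I m)
    (hy : y ∈ longSpan I n) : x * y ∈ longSpan I (m + n) := by
  refine mul_mem_pathSpan (fun {_ _ _ q p} (hq : m ≤ q.length) (hp : n ≤ p.length) => ?_) hx hy
  exact (add_comm m n).trans_le ((add_le_add hp hq).trans_eq (Path.length_comp p q).symm)

theorem pow_mem_longSpan {x : PathAlgebra k V ⧸ I} (hx : x ∈ longSpan I 1) (n : ℕ) :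
    x ^ n ∈ longSpan I n := by
  induction n with
  | zero => exact mem_longSpan_zero _
  | succ n ih => exact pow_succ x n ▸ mul_mem_longSpan ih hx

end PathSpan

section Jacobson

variable {k : Type u} {V : Type v} [Field k] [Quiver.{w} V] [Fintype V]
  {I : Ideal (PathAlgebra k V)} [I.IsTwoSided]

theorem exists_smul_add_mem_longSpan (x : PathAlgebra k V ⧸ I) (a : V) :
    ∃ c : k, ∃ n ∈ longSpan I 1,
      x * cls I (Path.nil : Path a a) = c • cls I (Path.nil : Path a a) + n := by
  refine Submodule.mem_span_insert.1 ?_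
  rw [← Set.image_insert_eq (f := fun q : QPath V => cls I q.path) (a := ⟨a, a, Path.nil⟩)]
  refine mul_mem_pathSpan (T := {⟨a, a, Path.nil⟩}) ?_ (mem_longSpan_zero x) (cls_mem_pathSpan rfl)
  rintro _ _ _ q _ - ⟨⟩
  cases q with
  | nil => exact .inl rfl
  | cons q α => exact .inr (by simp)

variable {m : ℕ} (hI : (longPaths k V m : Set (PathAlgebra k V)) ⊆ I)

include hI

theorem longSpan_le_jacobson :
    longSpan I 1 ≤ (Ring.jacobson (PathAlgebra k V ⧸ I)).restrictScalars k := by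
  intro x hx
  rw [Submodule.restrictScalars_mem, ← Ideal.jacobson_bot, Ideal.mem_jacobson_iff]
  intro y
  have hyx : y * x ∈ longSpan I 1 := by simpa using mul_mem_longSpan (mem_longSpan_zero y) hx
  have hnil : IsNilpotent (y * x) :=
    ⟨m, (Submodule.mem_bot k).1 (longSpan_eq_bot hI ▸ pow_mem_longSpan hyx m)⟩
  obtain ⟨z, hz⟩ := hnil.isUnit_one_add.exists_left_inv
  refine ⟨z, ?_⟩
  rw [Ideal.mem_bot, mul_assoc, ← hz, mul_add, mul_one, add_comm, sub_self]

theorem cls_mem_jacobson {a b : V} {q : Path a b} (hq : 0 < q.length) :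
    cls I q ∈ Ring.jacobson (PathAlgebra k V ⧸ I) :=
  longSpan_le_jacobson hI (cls_mem_pathSpan hq)

theorem jacobson_eq_longSpan :
    (Ring.jacobson (PathAlgebra k V ⧸ I)).restrictScalars k = longSpan I 1 := by
  refine le_antisymm (fun x hx => ?_) (longSpan_le_jacobson hI)
  rw [← mul_one x, one_eq_sum_cls, Finset.mul_sum]
  refine Submodule.sum_mem _ fun a _ => ?_
  obtain ⟨c, n, hn, h⟩ := exists_smul_add_mem_longSpan x a
  have hc : c • cls I (Path.nil : Path a a) ∈ Ring.jacobson (PathAlgebra k V ⧸ I) := by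
    rw [eq_sub_of_add_eq h.symm]
    exact sub_mem (Ideal.mul_mem_right _ _ hx) (longSpan_le_jacobson hI hn)
  have hc0 : c • cls I (Path.nil : Path a a) = 0 :=
    smul_eq_zero.2 <| or_iff_not_imp_left.2 fun hne =>
      eq_zero_of_isIdempotentElem_of_mem_jacobson (isIdempotentElem_cls_nil a)
        ((Submodule.smul_mem_iff _ hne).1 hc)
  rwa [h, hc0, zero_add]

theorem exists_mul_cls_eq_smul_add (x : PathAlgebra k V ⧸ I) {b c : V} (u : Path b c) :
    ∃ t : k, ∃ n ∈ Ring.jacobson (PathAlgebra k V ⧸ I),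
      x * cls I u = t • cls I u + n * cls I u := by
  obtain ⟨t, n, hn, h⟩ := exists_smul_add_mem_longSpan x c
  refine ⟨t, n, longSpan_le_jacobson hI hn, ?_⟩
  have hu : cls I (Path.nil : Path c c) * cls I u = cls I u := cls_mul_cls _ _
  rw [← hu, ← mul_assoc, h, add_mul, smul_mul_assoc, hu]

end Jacobson

section MastElement

variable {k : Type u} {V : Type v} [Field k] [Quiver.{w} V] [Fintype V]
  {I : Ideal (PathAlgebra k V)} [I.IsTwoSided]
  {U : Type*} [AddCommGroup U] [Module (PathAlgebra k V ⧸ I) U]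

theorem cls_cons_smul {a b c : V} (u : Path a b) (α : b ⟶ c) (y : U) :
    cls I (u.cons α) • y = cls I α.toPath • cls I u • y := by
  rw [smul_smul, cls_mul_cls, Path.comp_toPath_eq_cons]

variable (I) in
/-- `y` is a top element with mast `p` of the submodule `Λy`, whose length `length p + 1` is
expressed as the height of `Λy` in the lattice of submodules. -/
structure IsMastElement {a b : V} (p : Path a b) (y : U) : Prop where
  nil_smul : cls I (Path.nil : Path a a) • y = y
  smul_ne_zero : cls I p • y ≠ 0
  height_le : Order.height (Submodule.span (PathAlgebra k V ⧸ I) {y}) ≤ (p.length + 1 : ℕ)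

theorem IsMastElement.jacobson_smul_span_eq_bot {a : V} {y : U}
    (h : IsMastElement I (Path.nil : Path a a) y) :
    Ring.jacobson (PathAlgebra k V ⧸ I) • Submodule.span (PathAlgebra k V ⧸ I) {y} = ⊥ := by
  have hy : y ≠ 0 := h.nil_smul ▸ h.smul_ne_zero
  have hle := (Order.height_add_one_le (jacobson_smul_span_singleton_lt hy)).trans h.height_le
  rw [← isMin_iff_eq_bot, ← Order.height_eq_zero, ← nonpos_iff_eq_zero]
  exact (ENat.add_le_add_iff_right ENat.one_ne_top).1 (by simpa using hle)

variable {m : ℕ} (hI : (longPaths k V m : Set (PathAlgebra k V)) ⊆ I)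

include hI

theorem mul_cls_mem_radMulPath {a b : V} {u : Path a b} {y : U} (hu : cls I u • y ≠ 0)
    {x : PathAlgebra k V ⧸ I} (hx : (x * cls I u) • y = 0) : x * cls I u ∈ radMulPath I u := by
  obtain ⟨t, n, hn, h⟩ := exists_mul_cls_eq_smul_add hI x u
  suffices ht : t = 0 from ⟨n, hn, by rw [h, ht, zero_smul, zero_add]; rfl⟩
  by_contra ht
  refine notMem_jacobson_smul_span_singleton hu
    (Submodule.mem_smul_span_singleton.2 ⟨-algebraMap k _ t⁻¹ * n, Ideal.mul_mem_left _ _ hn, ?_⟩)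
  have hu' : cls I u = t⁻¹ • (x * cls I u) + -algebraMap k _ t⁻¹ * (n * cls I u) := by
    rw [h, smul_add, inv_smul_smul₀ ht, neg_mul, ← Algebra.smul_def, add_neg_cancel_right]
  conv_rhs => rw [hu', add_smul, Algebra.smul_def, mul_smul, hx, smul_zero, zero_add]
  simp only [mul_smul]

theorem span_cls_toPath_smul_le {a b : V} (α : a ⟶ b) (y : U) :
    Submodule.span (PathAlgebra k V ⧸ I) {cls I α.toPath • y} ≤
      Ring.jacobson (PathAlgebra k V ⧸ I) • Submodule.span (PathAlgebra k V ⧸ I) {y} :=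
  (Submodule.span_singleton_le_iff_mem _ _).2 <| Submodule.mem_smul_span_singleton.2
    ⟨_, cls_mem_jacobson hI (q := α.toPath) Nat.one_pos, rfl⟩

theorem height_span_add_length_le {a b : V} (r : Path a b) {y : U} (hy : cls I r • y ≠ 0) :
    Order.height (Submodule.span (PathAlgebra k V ⧸ I) {cls I r • y}) + r.length ≤
      Order.height (Submodule.span (PathAlgebra k V ⧸ I) {y}) := by
  induction r with
  | nil =>
    rw [Path.length_nil, Nat.cast_zero, add_zero]
    exact Order.height_mono ((Submodule.span_singleton_le_iff_mem _ _).2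
      (Submodule.smul_mem _ _ (Submodule.mem_span_singleton_self y)))
  | cons r α ih =>
    have hr : cls I r • y ≠ 0 := fun h => hy (by rw [cls_cons_smul, h, smul_zero])
    have hlt := (span_cls_toPath_smul_le hI α (cls I r • y)).trans_lt
      (jacobson_smul_span_singleton_lt hr)
    rw [← cls_cons_smul] at hlt
    refine le_trans ?_ (ih hr)
    rw [Path.length_cons, Nat.cast_succ, add_comm (r.length : ℕ∞), ← add_assoc]
    exact add_le_add_left (Order.height_add_one_le hlt) _

namespace IsMastElement

variable {a b c d : V} {y : U}

theorem height_eq {p : Path a b} (h : IsMastElement I p y) :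
    Order.height (Submodule.span (PathAlgebra k V ⧸ I) {y}) = (p.length + 1 : ℕ) := by
  refine h.height_le.antisymm (le_trans ?_ (height_span_add_length_le hI p h.smul_ne_zero))
  rw [Nat.cast_succ, add_comm]
  exact add_le_add_left (one_le_height_span_singleton h.smul_ne_zero) _

theorem cls_smul {u : Path a c} {r : Path c b} (h : IsMastElement I (u.comp r) y) :
    IsMastElement I r (cls I u • y) where
  nil_smul := by rw [smul_smul, cls_mul_cls, Path.comp_nil]
  smul_ne_zero := by rw [smul_smul, cls_mul_cls]; exact h.smul_ne_zero
  height_le := by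
    have hu : cls I u • y ≠ 0 := fun hu => h.smul_ne_zero (by
      rw [← cls_mul_cls, mul_smul, hu, smul_zero])
    have hle := (height_span_add_length_le hI u hu).trans h.height_le
    rw [Path.length_comp, add_assoc, add_comm, Nat.cast_add] at hle
    exact (ENat.add_le_add_iff_left (ENat.natCast_ne_top _)).1 hle

theorem jacobson_smul_span_eq_span {α : a ⟶ c} {r : Path c b}
    (h : IsMastElement I (α.toPath.comp r) y) :
    Ring.jacobson (PathAlgebra k V ⧸ I) • Submodule.span (PathAlgebra k V ⧸ I) {y} =
      Submodule.span (PathAlgebra k V ⧸ I) {cls I α.toPath • y} := by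
  by_contra hne
  have hy : y ≠ 0 := fun hy => h.smul_ne_zero (by rw [hy, smul_zero])
  have hlt := lt_of_le_of_ne (span_cls_toPath_smul_le hI α y) (Ne.symm hne)
  have hle := (add_le_add_left (Order.height_add_one_le hlt) 1).trans
    ((Order.height_add_one_le (jacobson_smul_span_singleton_lt hy)).trans h.height_le)
  rw [(h.cls_smul hI).height_eq hI, Path.length_comp, Path.length_toPath] at hle
  norm_cast at hle
  omega

end IsMastElement

theorem IsMast.exists_isMastElement {a b : V} {p : Path a b} (hp : IsMast I p U) :
    ∃ x : U, IsMastElement I p x ∧ Submodule.span (PathAlgebra k V ⧸ I) {x} = ⊤ := by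
  obtain ⟨hlen, x, hx⟩ := hp
  rw [Module.length_eq_height] at hlen
  have h : IsMastElement I p (cls I (Path.nil : Path a a) • x) :=
    ⟨by rw [smul_smul, isIdempotentElem_cls_nil], by
      rwa [smul_smul, cls_mul_cls, Path.nil_comp], hlen ▸ Order.height_mono le_top⟩
  refine ⟨_, h, by_contra fun hne => ?_⟩
  have hlt := Order.height_strictMono (lt_top_iff_ne_top.2 hne)
    (h.height_le.trans_lt (ENat.natCast_lt_top _))
  exact hlt.ne ((h.height_eq hI).trans hlen.symm)

end MastElement

section PathSpanMod

variable {k : Type u} {V : Type v} [Field k] [Quiver.{w} V] [Fintype V]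
  (I : Ideal (PathAlgebra k V)) [I.IsTwoSided]
  {U : Type*} [AddCommGroup U] [Module (PathAlgebra k V ⧸ I) U]

/-- The subspace of the elements of `Λ` which act on `x` like a linear combination of paths
in `S`. -/
noncomputable def pathSpanMod (S : Set (QPath V)) (x : U) : Submodule k (PathAlgebra k V ⧸ I) :=
  pathSpan I S ⊔ (Ideal.torsionOf (PathAlgebra k V ⧸ I) U x).restrictScalars k

variable {I} {S T : Set (QPath V)} {x : U} {a : PathAlgebra k V ⧸ I}

theorem mem_pathSpanMod : a ∈ pathSpanMod I S x ↔ ∃ t ∈ pathSpan I S, a • x = t • x := by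
  refine Submodule.mem_sup.trans ⟨?_, ?_⟩
  · rintro ⟨t, ht, z, hz, rfl⟩
    exact ⟨t, ht, by rw [add_smul, (Ideal.mem_torsionOf_iff x z).1 hz, add_zero]⟩
  · rintro ⟨t, ht, h⟩
    exact ⟨t, ht, a - t, (Ideal.mem_torsionOf_iff x _).2 (by rw [sub_smul, h, sub_self]),
      add_sub_cancel t a⟩

theorem pathSpan_le_pathSpanMod : pathSpan I S ≤ pathSpanMod I S x := le_sup_left

theorem pathSpanMod_mono (h : S ⊆ T) : pathSpanMod I S x ≤ pathSpanMod I T x :=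
  sup_le_sup_right (pathSpan_mono h) _

theorem smul_eq_zero_of_mem_pathSpanMod (hS : S = ∅) (ha : a ∈ pathSpanMod I S x) : a • x = 0 := by
  obtain ⟨t, ht, h⟩ := mem_pathSpanMod.1 ha
  rw [pathSpan, hS, Set.image_empty, Submodule.span_empty, Submodule.mem_bot] at ht
  rw [h, ht, zero_smul]

theorem mul_cls_mem_pathSpanMod {b c : V} {u : Path b c} (ha : a ∈ pathSpanMod I S (cls I u • x))
    (h : ∀ {d : V} {q : Path c d}, ⟨c, d, q⟩ ∈ S → ⟨b, d, u.comp q⟩ ∈ T) :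
    a * cls I u ∈ pathSpanMod I T x := by
  obtain ⟨t, ht, hat⟩ := mem_pathSpanMod.1 ha
  refine mem_pathSpanMod.2 ⟨t * cls I u, mul_mem_pathSpan (T := {⟨b, c, u⟩}) ?_ ht
    (cls_mem_pathSpan rfl), by rw [mul_smul, hat, mul_smul]⟩
  rintro _ _ _ q _ hq ⟨⟩
  exact h hq

theorem mul_mem_pathSpanMod (h : ∀ q ∈ S, a * cls I q.path ∈ pathSpanMod I T x)
    {y : PathAlgebra k V ⧸ I} (hy : y ∈ pathSpanMod I S x) : a * y ∈ pathSpanMod I T x := by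
  suffices hle : pathSpanMod I S x ≤ (pathSpanMod I T x).comap (LinearMap.mulLeft k a) from hle hy
  exact sup_le (pathSpan_le.2 h) fun z hz => Submodule.mem_sup_right (Ideal.mul_mem_left _ a hz)

theorem cls_nil_mul_mem_pathSpanMod (ha : a ∈ pathSpanMod I S x) (d : V) :
    cls I (Path.nil : Path d d) * a ∈ pathSpanMod I {q ∈ S | q.tgt = d} x := by
  refine mul_mem_pathSpanMod ?_ ha
  rintro ⟨b, c, q⟩ hq
  by_cases hc : c = d
  · subst hc
    exact cls_mul_cls (I := I) _ q ▸ pathSpan_le_pathSpanMod (cls_mem_pathSpan ⟨hq, rfl⟩)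
  · exact cls_mul_cls_of_ne (I := I) _ q hc ▸ zero_mem _

end PathSpanMod

section Action

variable {k : Type u} {V : Type v} [Field k] [Quiver.{w} V] [Fintype V]
  {I : Ideal (PathAlgebra k V)} [I.IsTwoSided]
  {U : Type*} [AddCommGroup U] [Module (PathAlgebra k V ⧸ I) U]
  {m : ℕ} (hI : (longPaths k V m : Set (PathAlgebra k V)) ⊆ I)

include hI

namespace IsMastElement

theorem jacobson_le_pathSpanMod {a b : V} {r : Path a b} {y : U} (h : IsMastElement I r y) :
    (Ring.jacobson (PathAlgebra k V ⧸ I)).restrictScalars k ≤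
      pathSpanMod I (positiveRightSubpaths r) y := by
  intro n hn
  have hny : n • y ∈ Ring.jacobson (PathAlgebra k V ⧸ I) •
      Submodule.span (PathAlgebra k V ⧸ I) {y} :=
    Submodule.smul_mem_smul hn (Submodule.mem_span_singleton_self y)
  induction hl : r.length generalizing a y n with
  | zero =>
    obtain rfl := Path.eq_of_length_zero r hl
    obtain rfl := Path.eq_nil_of_length_zero r hl
    rw [h.jacobson_smul_span_eq_bot, Submodule.mem_bot] at hny
    exact mem_pathSpanMod.2 ⟨0, zero_mem _, by rw [hny, zero_smul]⟩
  | succ l ih =>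
    obtain ⟨c, α, r, hr, rfl⟩ := Path.eq_toPath_comp_of_length_eq_succ r hl
    rw [h.jacobson_smul_span_eq_span hI] at hny
    obtain ⟨z, hz⟩ := Submodule.mem_span_singleton.1 hny
    obtain ⟨t, n', hn', hzα⟩ := exists_mul_cls_eq_smul_add hI z α.toPath
    have hrest : n' * cls I α.toPath ∈
        pathSpanMod I (positiveRightSubpaths (α.toPath.comp r)) y := by
      refine mul_cls_mem_pathSpanMod (ih (h.cls_smul hI) hn'
        (Submodule.smul_mem_smul hn' (Submodule.mem_span_singleton_self _)) hr) ?_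
      rintro _ q ⟨_, _, -, ⟨s, hs⟩, ⟨⟩⟩
      exact ⟨_, α.toPath.comp q, by simp, ⟨s, by rw [Path.comp_assoc, hs]⟩, rfl⟩
    have hα : cls I α.toPath ∈ pathSpan I (positiveRightSubpaths (α.toPath.comp r)) :=
      cls_mem_pathSpan ⟨c, α.toPath, Nat.one_pos, ⟨r, rfl⟩, rfl⟩
    obtain ⟨s, hs, hsy⟩ := mem_pathSpanMod.1
      (add_mem (Submodule.smul_mem _ t (pathSpan_le_pathSpanMod hα)) hrest)
    exact mem_pathSpanMod.2 ⟨s, hs, by rw [← hsy, ← hzα, mul_smul, hz]⟩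

variable {a b c d : V} {x : U}

theorem cls_cons_mem_pathSpanMod {u : Path a c} {r : Path c b}
    (h : IsMastElement I (u.comp r) x) (α : c ⟶ d) :
    cls I (u.cons α) ∈ pathSpanMod I (properExtensions (u.comp r) u d) x := by
  have hα := cls_nil_mul_mem_pathSpanMod ((h.cls_smul hI).jacobson_le_pathSpanMod hI
    (cls_mem_jacobson hI (q := α.toPath) Nat.one_pos)) d
  rw [cls_mul_cls, Path.comp_nil] at hα
  rw [← Path.comp_toPath_eq_cons, ← cls_mul_cls]
  refine mul_cls_mem_pathSpanMod hα ?_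
  rintro _ q ⟨⟨_, w, hw, ⟨s, hs⟩, ⟨⟩⟩, rfl⟩
  exact ⟨q, hw, ⟨s, by rw [Path.comp_assoc, hs]⟩, rfl⟩

theorem cls_mem_pathSpanMod {p : Path a b} (h : IsMastElement I p x) (q : Path a d) :
    cls I q ∈ pathSpanMod I {v | ∃ v' : Path a d, IsRightSubpath v' p ∧
      q.vertices.Sublist v'.vertices ∧ v = ⟨a, d, v'⟩} x := by
  induction q with
  | nil => exact pathSpan_le_pathSpanMod (cls_mem_pathSpan
      ⟨Path.nil, ⟨p, Path.nil_comp p⟩, .refl _, rfl⟩)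
  | cons q α ih =>
    rw [← Path.comp_toPath_eq_cons, ← cls_mul_cls]
    refine mul_mem_pathSpanMod ?_ ih
    rintro _ ⟨v, ⟨r, rfl⟩, hqv, rfl⟩
    rw [cls_mul_cls, Path.comp_toPath_eq_cons]
    refine pathSpanMod_mono ?_ (h.cls_cons_mem_pathSpanMod hI α)
    rintro _ ⟨w, hw, hvw, rfl⟩
    exact ⟨v.comp w, hvw, concat_sublist_vertices_comp hw hqv, rfl⟩

theorem cls_smul_eq_zero_of_not_isRoute {p : Path a b} (h : IsMastElement I p x) {q : Path a d}
    (hq : ¬ IsRoute p ⟨a, d, q⟩) : cls I q • x = 0 := by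
  refine smul_eq_zero_of_mem_pathSpanMod ?_ (h.cls_mem_pathSpanMod hI q)
  refine Set.eq_empty_of_forall_notMem ?_
  rintro _ ⟨v, ⟨r, rfl⟩, hqv, rfl⟩
  exact hq ⟨rfl, hqv.trans (vertices_sublist_comp v r)⟩

theorem eq_zero_of_mem_jacobson_smul_span {p : Path a b} (h : IsMastElement I p x)
    (hcyc : ¬ StartsWithCycle p) {z : U} (hz : z ∈ Ring.jacobson (PathAlgebra k V ⧸ I) •
      Submodule.span (PathAlgebra k V ⧸ I) {x}) (hez : cls I (Path.nil : Path a a) • z = z) :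
    z = 0 := by
  obtain ⟨n, hn, rfl⟩ := Submodule.mem_smul_span_singleton.1 hz
  rw [← hez, smul_smul]
  refine smul_eq_zero_of_mem_pathSpanMod ?_
    (cls_nil_mul_mem_pathSpanMod (h.jacobson_le_pathSpanMod hI hn) a)
  refine Set.eq_empty_of_forall_notMem ?_
  rintro _ ⟨⟨d, w, hw, hwp, rfl⟩, hd : d = a⟩
  subst hd
  exact hcyc ⟨w, hw, hwp⟩

end IsMastElement

end Action

section LeftProj

variable {k : Type u} {V : Type v} [Field k] [Quiver.{w} V] [Fintype V]
  {I : Ideal (PathAlgebra k V)} [I.IsTwoSided]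

theorem mem_leftProj {e : V} {a : PathAlgebra k V ⧸ I} :
    a ∈ leftProj I e ↔ a * cls I (Path.nil : Path e e) = a :=
  mem_span_singleton_iff_mul_eq_self (isIdempotentElem_cls_nil e)

theorem cls_mem_leftProj {e f : V} (p : Path e f) : cls I p ∈ leftProj I e :=
  mem_leftProj.2 (by rw [cls_mul_cls, Path.nil_comp])

instance projective_leftProj (e : V) : Module.Projective (PathAlgebra k V ⧸ I) (leftProj I e) :=
  projective_span_singleton (isIdempotentElem_cls_nil e)

instance finite_leftProj (e : V) : Module.Finite (PathAlgebra k V ⧸ I) (leftProj I e) :=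
  Module.Finite.iff_fg.2 (Submodule.fg_span_singleton _)

theorem radMulPath_le_pathSpan_not_isRoute {m : ℕ}
    (hI : (longPaths k V m : Set (PathAlgebra k V)) ⊆ I) {e f : V} (p : Path e f) :
    (radMulPath I p).restrictScalars k ≤ pathSpan I {q | ¬ IsRoute p q} := by
  rintro _ ⟨n, hn, rfl⟩
  have hnp : n * cls I p ∈ longSpan I (1 + p.length) :=
    mul_mem_longSpan ((jacobson_eq_longSpan hI).le hn) (cls_mem_pathSpan (le_refl p.length))
  exact pathSpan_mono (fun _ hq => not_isRoute_of_length_lt (Nat.one_add_le_iff.1 hq)) hnp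

theorem isInessential_of_mem_sup {e f c d : V} {p : Path e f} {α : c ⟶ d} {u : Path e c}
    (h : cls I (u.cons α) ∈ pathSpan I {q | ¬ IsRoute p q} ⊔ pathSpan I (properExtensions p u d)) :
    IsInessential I p α u := by
  obtain ⟨s, hs, t, ht, hst⟩ := Submodule.mem_sup.1 h
  refine ⟨s, Submodule.span_mono ?_ hs, t, Submodule.span_mono ?_ ht, hst.symm⟩
  · rintro _ ⟨q, hq, rfl⟩
    exact ⟨q, hq, rfl⟩
  · rintro _ ⟨_, ⟨w, hw, hp, rfl⟩, rfl⟩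
    exact ⟨u.comp w, hp, by rw [Path.length_comp]; omega, rfl⟩

variable {U : Type*} [AddCommGroup U] [Module (PathAlgebra k V ⧸ I) U] {e f : V} {x : U}

variable (I) in
/-- The map `Λe → U` sending `e` to `e x`. -/
noncomputable def leftProjMap (e : V) (x : U) : leftProj I e →ₗ[PathAlgebra k V ⧸ I] U :=
  LinearMap.toSpanSingleton _ U x ∘ₗ (leftProj I e).subtype

theorem leftProjMap_surjective (hex : cls I (Path.nil : Path e e) • x = x)
    (htop : Submodule.span (PathAlgebra k V ⧸ I) {x} = ⊤) :
    Function.Surjective (leftProjMap I e x) := by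
  intro y
  obtain ⟨a, rfl⟩ := Submodule.mem_span_singleton.1 (htop ▸ Submodule.mem_top : y ∈ _)
  exact ⟨a • ⟨_, cls_mem_leftProj Path.nil⟩, (map_smul _ _ _).trans (congrArg (a • ·) hex)⟩

section ProjectiveCover

variable {m : ℕ} (hI : (longPaths k V m : Set (PathAlgebra k V)) ⊆ I)

include hI

theorem ker_leftProjMap_le_jacobson (hex : cls I (Path.nil : Path e e) • x ≠ 0) :
    LinearMap.ker (leftProjMap I e x) ≤ Module.jacobson (PathAlgebra k V ⧸ I) (leftProj I e) := by
  rintro ⟨a, ha⟩ (hax : a • x = 0)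
  rw [← mem_leftProj.1 ha] at hax
  obtain ⟨n, hn, h⟩ := mul_cls_mem_radMulPath hI hex hax
  have han : (⟨a, ha⟩ : leftProj I e) = n • ⟨_, cls_mem_leftProj Path.nil⟩ :=
    Subtype.ext ((mem_leftProj.1 ha).symm.trans h.symm)
  exact Ring.jacobson_smul_top_le _ _ (han ▸ Submodule.smul_mem_smul hn Submodule.mem_top)

namespace IsMastElement

variable {p : Path e f} (h : IsMastElement I p x)
  (htop : Submodule.span (PathAlgebra k V ⧸ I) {x} = ⊤)

include h htop

theorem radical_fg : (radical (PathAlgebra k V ⧸ I) U).FG := by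
  rw [radical, ← htop]
  cases hp : p.length with
  | zero =>
    obtain rfl := Path.eq_of_length_zero p hp
    obtain rfl := Path.eq_nil_of_length_zero p hp
    exact h.jacobson_smul_span_eq_bot ▸ Submodule.fg_bot
  | succ l =>
    obtain ⟨c, α, r, -, rfl⟩ := Path.eq_toPath_comp_of_length_eq_succ p hp
    exact h.jacobson_smul_span_eq_span hI ▸ Submodule.fg_span_singleton _

omit hI in
theorem length_pos (hsplit : ¬ IsSplitMonoMap (radical (PathAlgebra k V ⧸ I) U).subtype) :
    0 < p.length := by
  refine Nat.pos_of_ne_zero fun hp => hsplit ⟨0, ?_⟩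
  obtain rfl := Path.eq_of_length_zero p hp
  obtain rfl := Path.eq_nil_of_length_zero p hp
  have hbot : radical (PathAlgebra k V ⧸ I) U = ⊥ := by
    rw [radical, ← htop, h.jacobson_smul_span_eq_bot]
  ext z
  exact ((Submodule.mem_bot _).1 (hbot.le z.2)).symm

theorem linearMap_leftProj_radical_eq_zero (hcyc : ¬ StartsWithCycle p)
    (φ : leftProj I e →ₗ[PathAlgebra k V ⧸ I] radical (PathAlgebra k V ⧸ I) U) : φ = 0 := by
  let ε : leftProj I e := ⟨_, cls_mem_leftProj Path.nil⟩
  have hε (a : leftProj I e) : a = (a : PathAlgebra k V ⧸ I) • ε :=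
    Subtype.ext (mem_leftProj.1 a.2).symm
  have hφε : φ ε = 0 := by
    refine Subtype.ext (h.eq_zero_of_mem_jacobson_smul_span hI hcyc (htop ▸ (φ ε).2) ?_)
    exact congrArg Subtype.val ((map_smul φ _ ε).symm.trans (congrArg φ (hε ε).symm))
  ext a
  rw [hε a, map_smul, hφε, smul_zero, LinearMap.zero_apply]

end IsMastElement

end ProjectiveCover

end LeftProj

section Kernel

variable {k : Type u} {V : Type v} [Field k] [Quiver.{w} V] [Fintype V]
  {I : Ideal (PathAlgebra k V)} [I.IsTwoSided] {m : ℕ}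
  (hI : (longPaths k V m : Set (PathAlgebra k V)) ⊆ I)
  {U : Type (max u v w)} [AddCommGroup U] [Module (PathAlgebra k V ⧸ I) U] {e f : V}
  {p : Path e f} {x : U} (h : IsMastElement I p x)
  (htop : Submodule.span (PathAlgebra k V ⧸ I) {x} = ⊤) (hcyc : ¬ StartsWithCycle p)
  (hirr : IsIrreducibleMap (radical (PathAlgebra k V ⧸ I) U).subtype)

namespace IsMastElement

include hI h htop hcyc hirr

theorem mem_radMulPath_of_smul_eq_zero {a : PathAlgebra k V ⧸ I} (ha : a ∈ leftProj I e)
    (hax : a • x = 0) : a ∈ radMulPath I p := by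
  have hx : cls I (Path.nil : Path e e) • x ≠ 0 := fun hx =>
    h.smul_ne_zero (by rw [← h.nil_smul, hx, smul_zero])
  let Q := (Submodule.span (PathAlgebra k V ⧸ I) {cls I p}).submoduleOf (leftProj I e)
  have hpQ : ⟨cls I p, cls_mem_leftProj p⟩ ∈ Q := Submodule.mem_span_singleton_self (cls I p)
  have hQ : Q ≤ (radical (PathAlgebra k V ⧸ I) U).comap (leftProjMap I e x) := by
    rintro ⟨_, _⟩ hq
    obtain ⟨b, rfl⟩ := Submodule.mem_span_singleton.1 hq
    exact Submodule.smul_mem_smul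
      (Ideal.mul_mem_left _ b (cls_mem_jacobson hI (h.length_pos htop hirr.1))) Submodule.mem_top
  rcases le_ker_or_ker_le_of_isIrreducibleMap (ker_leftProjMap_le_jacobson hI hx)
    (h.radical_fg hI htop) hirr (h.linearMap_leftProj_radical_eq_zero hI htop hcyc) hQ
    with hle | hle
  · exact absurd (hle hpQ) h.smul_ne_zero
  · obtain ⟨b, rfl⟩ := Submodule.mem_span_singleton.1 (hle (x := ⟨a, ha⟩) hax)
    exact mul_cls_mem_radMulPath hI h.smul_ne_zero hax

theorem ker_leftProjMap :
    LinearMap.ker (leftProjMap I e x) = (radMulPath I p).submoduleOf (leftProj I e) := by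
  refine le_antisymm (fun a => h.mem_radMulPath_of_smul_eq_zero hI htop hcyc hirr a.2) ?_
  rintro ⟨_, _⟩ ⟨n, hn, rfl⟩
  have hbot := (cls_smul hI (r := Path.nil) h).jacobson_smul_span_eq_bot
  rw [Submodule.eq_bot_iff] at hbot
  exact (smul_smul n (cls I p) x).symm.trans
    (hbot _ (Submodule.smul_mem_smul hn (Submodule.mem_span_singleton_self _)))

theorem isInessential {c d : V} {u : Path e c} (hu : IsRightSubpath u p) (α : c ⟶ d) :
    IsInessential I p α u := by
  obtain ⟨r, rfl⟩ := hu
  obtain ⟨t, ht, hαt⟩ := mem_pathSpanMod.1 (h.cls_cons_mem_pathSpanMod hI α)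
  have hte : t ∈ leftProj I e := by
    refine (pathSpan_le (N := (leftProj I e).restrictScalars k)).2 ?_ ht
    rintro _ ⟨w, -, -, rfl⟩
    exact cls_mem_leftProj _
  have hrad := h.mem_radMulPath_of_smul_eq_zero hI htop hcyc hirr
    (sub_mem (cls_mem_leftProj (u.cons α)) hte) (by rw [sub_smul, hαt, sub_self])
  exact isInessential_of_mem_sup (Submodule.mem_sup.2
    ⟨_, radMulPath_le_pathSpan_not_isRoute hI _ hrad, t, ht, sub_add_cancel _ t⟩)

end IsMastElement

end Kernel

end QuiverAlgebra

theorem mainTheorem4_general {k : Type u} {V : Type v} [Field k] [Quiver.{w} V] [Fintype V]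
    (I : Ideal (PathAlgebra k V)) [I.IsTwoSided]
    {m : ℕ} (hI : (longPaths k V m : Set (PathAlgebra k V)) ⊆ I)
    (U : Type (max u v w)) [AddCommGroup U] [Module (PathAlgebra k V ⧸ I) U]
    {e f : V} (p : Quiver.Path e f) (hp : IsMast I p U)
    (hcyc : ¬ StartsWithCycle p)
    (hirr : IsIrreducibleMap
      (radical (PathAlgebra k V ⧸ I) U).subtype) :
    (∀ {c d : V} (α : c ⟶ d) (u : Quiver.Path e c),
      IsDetour p α u → IsInessential I p α u) ∧
    (∀ q : QPath V, IsNonRoute p q →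
      cls I q.path ∈ radMulPath I p) ∧
    Nonempty (U ≃ₗ[PathAlgebra k V ⧸ I]
      (leftProj I e ⧸
        (radMulPath I p).submoduleOf (leftProj I e))) := by
  obtain ⟨x, hx, htop⟩ := hp.exists_isMastElement hI
  refine ⟨fun α u hd => hx.isInessential hI htop hcyc hirr hd.1 α, ?_, ?_⟩
  · rintro ⟨_, d, q⟩ ⟨rfl, hq⟩
    exact hx.mem_radMulPath_of_smul_eq_zero hI htop hcyc hirr (cls_mem_leftProj q)
      (hx.cls_smul_eq_zero_of_not_isRoute hI hq)
  · have hsurj := leftProjMap_surjective hx.nil_smul htop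
    exact ⟨((leftProjMap I e x).quotKerEquivOfSurjective hsurj).symm.trans
      (Submodule.quotEquivOfEq _ _ (hx.ker_leftProjMap hI htop hcyc hirr))⟩

theorem mainTheorem4 {k : Type u} {V : Type v} [Field k] [Quiver.{w} V] [Fintype V]
    [∀ a b : V, Finite (a ⟶ b)]
    (I : Ideal (PathAlgebra k V)) [I.IsTwoSided]
    (hI : IsAdmissible I)
    (U : Type (max u v w)) [AddCommGroup U] [Module (PathAlgebra k V ⧸ I) U]
    [Module.Finite (PathAlgebra k V ⧸ I) U]
    (hU : IsUniserial (PathAlgebra k V ⧸ I) U)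
    (hns : ¬ IsSimpleModule (PathAlgebra k V ⧸ I) U)
    {e f : V} (p : Quiver.Path e f) (hp : IsMast I p U)
    (hcyc : ¬ StartsWithCycle p)
    (hirr : IsIrreducibleMap
      (radical (PathAlgebra k V ⧸ I) U).subtype) :
    (∀ {c d : V} (α : c ⟶ d) (u : Quiver.Path e c),
      IsDetour p α u → IsInessential I p α u) ∧
    (∀ q : QPath V, IsNonRoute p q →
      cls I q.path ∈ radMulPath I p) ∧
    Nonempty (U ≃ₗ[PathAlgebra k V ⧸ I]
      (leftProj I e ⧸
        (radMulPath I p).submoduleOf (leftProj I e))) := by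
  obtain ⟨⟨m, -, hm⟩, -⟩ := hI
  exact mainTheorem4_general I hm U p hp hcyc hirr
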